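/- Fix a finite set $P$ of binary node features. A graph $G=(V,E,\mathrm{lab})$ has a finite node set $V$, a symmetric irreflexive edge relation $E\subseteq V\times V$ and a labelling $\mathrm{lab}:V\to 2^P$; it need not be connected. Write $\oplus$ for concatenation of vectors, $\delta$ for Kronecker's delta, $\mathcal M(X)$ for the set of finite multisets over $X$, and $|G|=|V|$. **HE-GNNs.** A $(D,D')$-GNN consists of $L\ge 1$ layers, given by arbitrary functions $\mathrm{agg}_i:\mathcal M(\mathbb R^{D_i})\to\mathbb R^{D_i}$ and $\mathrm{com}_i:\mathbb R^{2D_i}\to\mathbb R^{D_{i+1}}$ $(1\le i\le L)$, where $D_1=D$, $D_{L+1}=D'$ and $D_i\ge 1$ for $i\ge 2$. Its $i$-th layer maps an embedding $\mathrm{emb}:V\to\mathbb R^{D_i}$ to $v\mapsto \mathrm{com}_i\big(\mathrm{emb}(v)\oplus \mathrm{agg}_i(\{\!\{\mathrm{emb}(u)\mid (v,u)\in E\}\!\})\big)$; $\mathrm{run}_{\mathcal A}(G,\mathrm{emb})$ is the result of applying all layers of $\mathcal A$ in order. A $(D,D')$-HE-GNN of nesting depth $0$ is a $(D,D')$-GNN.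 One of nesting depth $d>0$ is a pair $(\mathcal B,\mathcal C)$ of a $(D+1,D'')$-HE-GNN $\mathcal B$ of nesting depth $d-1$ and a $(D+D'',D')$-GNN $\mathcal C$; its run on $(G,\mathrm{emb})$ is $\mathrm{run}_{\mathcal C}(G,\mathrm{emb}')$, where $\mathrm{emb}'(v)=\mathrm{emb}(v)\oplus \mathrm{run}_{\mathcal B}\big(G,\,u\mapsto \mathrm{emb}(u)\oplus\delta_{uv}\big)(v)$. A $(|P|,1)$-HE-GNN $\mathcal A$ defines the node classifier $\mathrm{cls}_{\mathcal A}$ with $\mathrm{cls}_{\mathcal A}(G,v)=1$ if $\mathrm{run}_{\mathcal A}(G,\mathrm{emb}_G)(v)>0$ and $\mathrm{cls}_{\mathcal A}(G,v)=0$ otherwise, where $\mathrm{emb}_G:V\to\{0,1\}^{|P|}$ is the multi-hot encoding of $\mathrm{lab}$. Write $G\equiv_{\mathrm{HE\text{-}GNN}\text{-}d}G'$ if $\{\!\{\mathrm{cls}_{\mathcal A}(G,v)\mid v\in V\}\!\}=\{\!\{\mathrm{cls}_{\mathcal A}(G',v)\mid v\in V'\}\!\}$ for all $(|P|,1)$-HE-GNNs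 $\mathcal A$ of nesting depth $d$. **Individualization-refinement.** Fix a countably infinite, linearly ordered set of colors and an injective function $\mathrm{hash}$ into the colors, whose arguments are label sets, pairs (color, finite multiset of colors), and pairs (color, element of $\{0,1\}$). For a coloring $\mathrm{col}$ of $V$ let $\mathrm{WL}(G,\mathrm{col},0)=\mathrm{col}$ and, with $c_k=\mathrm{WL}(G,\mathrm{col},k)$, let $\mathrm{WL}(G,\mathrm{col},k+1)(v)=\mathrm{hash}\big(c_k(v),\{\!\{c_k(u)\mid (v,u)\in E\}\!\}\big)$. A coloring is discrete if all its color classes are singletons. The rooted tree $\mathrm{WL\text{-}IR}(G,\mathrm{col},d)$, whose nodes are labelled by colorings of $V$, is defined as follows. Let $\mathrm{col}'=\mathrm{WL}(G,\mathrm{col},|G|)$. If $\mathrm{col}'$ is discrete or $d=0$, the tree is the single node $\mathrm{col}'$. Otherwise let $c$ be the least color with $|\mathrm{col}'^{-1}(c)|\ge 2$ and $\mathrm{col}'^{-1}(c)=\{v_1,\dots,v_n\}$; the root is $\mathrm{col}'$ and its subtrees are $\mathrm{WL\text{-}IR}(G,\mathrm{col}'_i,d-1)$ for $1\le i\le n$,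 where $\mathrm{col}'_i(v)=\mathrm{hash}(\mathrm{col}'(v),\delta_{vv_i})$. Let $\mathrm{WL\text{-}IR}(G,d)$ be this tree for the initial coloring $v\mapsto\mathrm{hash}(\mathrm{lab}(v))$. Write $G\equiv_{\mathrm{WL\text{-}IR}\text{-}d}G'$ if $\mathrm{WL\text{-}IR}(G,d)$ and $\mathrm{WL\text{-}IR}(G',d)$ are isomorphic as unordered rooted trees, by an isomorphism such that the colorings at corresponding tree nodes have the same multiset of colors. **Theorem.** For every $d\ge 0$ and all graphs $G,G'$: if $G\not\equiv_{\mathrm{WL\text{-}IR}\text{-}d}G'$, then $G\not\equiv_{\mathrm{HE\text{-}GNN}\text{-}d}G'$. -/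

import Mathlib

namespace EgoNet

/-- A graph with binary node features from `P`: a symmetric and irreflexive edge relation on the
node set `V`, with a labelling of every node by a set of features. -/
structure LabeledGraph (P : Type*) (V : Type*) where
  graph : SimpleGraph V
  lab : V → Set P

section Basic

variable {P V X : Type*} [Fintype V]

/-- The multiset of all values of a function on the nodes. -/
def nodeMultiset (f : V → X) : Multiset X :=
  (Finset.univ : Finset V).val.map f

open Classical in
/-- The multiset of the values of `f` at the neighbours of `v`. -/
noncomputable def nbrMultiset (G : LabeledGraph P V) (f : V → X) (v : V) : Multiset X :=
  ((Finset.univ : Finset V).filter (fun u => G.graph.Adj v u)).val.map f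

end Basic

/-! ## Graph neural networks -/

/-- One layer: an arbitrary aggregation function on finite multisets of vectors and an arbitrary
combination function.  The output dimension of a layer is positive. -/
structure GNNLayer (D D' : ℕ) where
  agg : Multiset (Fin D → ℝ) → (Fin D → ℝ)
  com : (Fin (D + D) → ℝ) → (Fin D' → ℝ)
  pos : 1 ≤ D'

/-- A graph neural network with input dimension `D` and output dimension `D'`: a nonempty
sequence of layers with matching dimensions. -/
inductive GNN : ℕ → ℕ → Type
  | last {D D' : ℕ} (l : GNNLayer D D') : GNN D D'
  | cons {D M D' : ℕ} (l : GNNLayer D M) (A : GNN M D') : GNN D D'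

/-- A hierarchical ego graph neural network, `HEGNN d D D'`, of nesting depth `d`, input
dimension `D` and output dimension `D'`. -/
inductive HEGNN : ℕ → ℕ → ℕ → Type
  | base {D D' : ℕ} (A : GNN D D') : HEGNN 0 D D'
  | nest {d D M D' : ℕ} (B : HEGNN d (D + 1) M) (A : GNN (D + M) D') : HEGNN (d + 1) D D'

section Run

variable {P V : Type*} [Fintype V]

/-- The new embedding computed by one layer. -/
noncomputable def GNNLayer.run {D D' : ℕ} (l : GNNLayer D D') (G : LabeledGraph P V)
    (emb : V → Fin D → ℝ) : V → Fin D' → ℝ :=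
  fun v => l.com (Fin.append (emb v) (l.agg (nbrMultiset G emb v)))

/-- The embedding computed by a GNN. -/
noncomputable def GNN.run (G : LabeledGraph P V) :
    {D D' : ℕ} → GNN D D' → (V → Fin D → ℝ) → V → Fin D' → ℝ
  | _, _, .last l, emb => l.run G emb
  | _, _, .cons l A, emb => A.run G (l.run G emb)

open Classical in
/-- Append to the embedding of each node `u` the Kronecker delta of `u` and `v`. -/
noncomputable def mark {D : ℕ} (emb : V → Fin D → ℝ) (v : V) : V → Fin (D + 1) → ℝ :=
  fun u => Fin.append (emb u) (fun _ : Fin 1 => if u = v then (1 : ℝ) else 0)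

/-- The embedding computed by an HE-GNN. -/
noncomputable def HEGNN.run (G : LabeledGraph P V) :
    {d D D' : ℕ} → HEGNN d D D' → (V → Fin D → ℝ) → V → Fin D' → ℝ
  | _, _, _, .base A, emb => A.run G emb
  | _, _, _, .nest B A, emb =>
      A.run G (fun v => Fin.append (emb v) (B.run G (mark emb v) v))

open Classical in
/-- The multi-hot label encoding of a graph. -/
noncomputable def multiHot [Fintype P] (G : LabeledGraph P V) :
    V → Fin (Fintype.card P) → ℝ :=
  fun v i => if (Fintype.equivFin P).symm i ∈ G.lab v then 1 else 0

open Classical in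
/-- The node classifier, with values in `{0, 1}`, defined by an HE-GNN. -/
noncomputable def HEGNN.cls [Fintype P] {d : ℕ} (A : HEGNN d (Fintype.card P) 1)
    (G : LabeledGraph P V) (v : V) : Fin 2 :=
  if 0 < A.run G (multiHot G) v 0 then 1 else 0

end Run

/-- Two graphs are indistinguishable by HE-GNNs of nesting depth `d` if every classifier defined
by such an HE-GNN has the same multiset of values on both. -/
def HEGNNEquiv {P V V' : Type*} [Fintype P] [Fintype V] [Fintype V'] (d : ℕ)
    (G : LabeledGraph P V) (G' : LabeledGraph P V') : Prop :=
  ∀ A : HEGNN d (Fintype.card P) 1, nodeMultiset (A.cls G) = nodeMultiset (A.cls G')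

/-! ## Weisfeiler Leman and individualization-refinement -/

/-- The possible arguments of the hash function: a label, a colour with a multiset of colours, or
a colour with a Kronecker delta. -/
inductive HashInput (P C : Type*) where
  | label (s : Set P)
  | refine (c : C) (m : Multiset C)
  | indiv (c : C) (b : Fin 2)

section WL

variable {P C V : Type*} [Fintype V]

/-- The initial colouring. -/
def initCol (hash : HashInput P C → C) (G : LabeledGraph P V) : V → C :=
  fun v => hash (.label (G.lab v))

/-- `k` rounds of the Weisfeiler Leman algorithm. -/
noncomputable def wl (hash : HashInput P C → C) (G : LabeledGraph P V) (col : V → C) :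
    ℕ → V → C
  | 0 => col
  | k + 1 => fun v =>
      hash (.refine (wl hash G col k v) (nbrMultiset G (wl hash G col k) v))

open Classical in
/-- Individualization of the node `w` in a colouring. -/
noncomputable def individualize (hash : HashInput P C → C) (col : V → C) (w : V) : V → C :=
  fun v => hash (.indiv (col v) (if v = w then 1 else 0))

/-- A colouring is discrete if every colour class is a singleton. -/
def IsDiscrete (col : V → C) : Prop :=
  ∀ v, col ⁻¹' {col v} = {v}

open Classical in
/-- The class of nodes with colour `c`. -/
noncomputable def colorClass (col : V → C) (c : C) : Finset V :=
  (Finset.univ : Finset V).filter (fun v => col v = c)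

open Classical in
/-- The colours whose class has at least two nodes. -/
noncomputable def repeatedColors (col : V → C) : Finset C :=
  ((Finset.univ : Finset V).image col).filter (fun c => 2 ≤ (colorClass col c).card)

theorem repeatedColors_nonempty {col : V → C} (h : ¬ IsDiscrete col) :
    (repeatedColors col).Nonempty := by
  classical
  unfold IsDiscrete at h
  push Not at h
  obtain ⟨v, hv⟩ := h
  obtain ⟨w, hw, hne⟩ : ∃ w, col w = col v ∧ w ≠ v := by
    by_contra hcon
    push Not at hcon
    apply hv
    ext w
    simp only [Set.mem_preimage, Set.mem_singleton_iff]
    exact ⟨fun e => hcon w e, fun e => by rw [e]⟩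
  refine ⟨col v, ?_⟩
  simp only [repeatedColors, Finset.mem_filter, Finset.mem_image, Finset.mem_univ, true_and]
  refine ⟨⟨v, rfl⟩, ?_⟩
  have : 1 < (colorClass col (col v)).card :=
    Finset.one_lt_card.mpr ⟨w, by simp [colorClass, hw], v, by simp [colorClass], hne⟩
  exact this

/-- Finite rooted trees whose nodes carry colourings of `V`; the children of a tree node are
indexed by a finite set of elements of `V` and are not ordered. -/
inductive ColTree (V C : Type*) where
  | node (col : V → C) (s : Finset V) (child : {v // v ∈ s} → ColTree V C) : ColTree V C

/-- The tree that consists of a single node. -/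
def ColTree.leaf (col : V → C) : ColTree V C :=
  .node col ∅ (fun i => absurd i.2 (Finset.notMem_empty i.1))

open Classical in
/-- The tree of colourings computed by individualization-refinement with `d` rounds. -/
noncomputable def wlir [LinearOrder C] (hash : HashInput P C → C) (G : LabeledGraph P V) :
    (col : V → C) → (d : ℕ) → ColTree V C
  | col, 0 => .leaf (wl hash G col (Fintype.card V))
  | col, d + 1 =>
      let col' := wl hash G col (Fintype.card V)
      if h : IsDiscrete col' then .leaf col'
      else
        .node col' (colorClass col' ((repeatedColors col').min' (repeatedColors_nonempty h)))
          (fun w => wlir hash G (individualize hash col' w.1) d)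

/-- Isomorphism of trees of colourings of two graphs: a matching of the roots and, recursively, of
the children, under which the colourings at matched tree nodes use every colour equally often. -/
def ColTree.Iso {V' : Type*} [Fintype V'] : ColTree V C → ColTree V' C → Prop
  | .node col s child, .node col' s' child' =>
      nodeMultiset col = nodeMultiset col' ∧
        ∃ e : {v // v ∈ s} ≃ {v // v ∈ s'}, ∀ i, (child i).Iso (child' (e i))

/-- Two graphs are indistinguishable by individualization-refinement with `d` rounds. -/
def WLIREquiv {V' : Type*} [Fintype V'] [LinearOrder C] (hash : HashInput P C → C) (d : ℕ)
    (G : LabeledGraph P V) (G' : LabeledGraph P V') : Prop :=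
  (wlir hash G (initCol hash G) d).Iso (wlir hash G' (initCol hash G') d)

end WL

end EgoNet

/-!
Isomorphism of the individualization-refinement trees of depth `d` follows from HE-GNN equivalence
at depth `d`, which is the contrapositive of the claim.

Aggregation and combination functions are arbitrary, and there are only continuum many real vectors
and finite multisets of real vectors, so a layer can apply an injective hash to the colour of a node
and the multiset of the colours of its neighbours. Hence, for every number `n` of rounds, one HE-GNN
of nesting depth `d` runs `n` rounds of refinement on every nesting level. It computes the
colouring `egoColor`, and completing it by the indicator functions of single colours turns equality
of all classifier multisets into equality of the multisets of ego colours
(`HEGNNEquiv.nodeMultiset_egoColor_eq`). With `n = |V| + |V'|` all these colourings are stable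
across the two graphs (`nbrMultiset_wl_eq`).

The trees are then matched by induction on `d` (`wlir_iso`). Ego colours determine the refined
colouring at the root, and a bijection of the nodes that preserves ego colours of depth `d + 1`
matches the nodes `w`, `w'` that are individualized. The induction needs that marking `w` and `w'`
leaves the multisets of ego colours of depth `d` equal (`nodeMultiset_egoColor_mark_eq`). The graphs
may be disconnected, and a network that marks `w` only sees the component of `w`, so two cases are
distinguished:

* in the components of `w` and `w'`, counting edges between colour classes from both sides, along
  walks that start at the uniquely coloured marked node, shows that all colours occur equally often
  (`CrossStable.map_component_eq`);
* outside the components the mark has no effect, since ego colours are local (`egoColor_transfer`),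
  and the multisets agree there because they agree on the whole graphs and on the components.
-/

namespace EgoNet

/-! ### Multisets of values -/

/-- Two families with the same multiset of `f`-values also have the same multiset of `g`-values
if `g` is determined by `f` across the two families. -/
theorem map_eq_map_of_imp {α β X Y : Type*} {s : Multiset α} {t : Multiset β}
    {f : α → X} {f' : β → X} {g : α → Y} {g' : β → Y} (h : s.map f = t.map f')
    (hi : ∀ x ∈ s, ∀ y ∈ t, f x = f' y → g x = g' y) : s.map g = t.map g' := by
  rw [← Multiset.rel_eq, Multiset.rel_map] at h ⊢
  exact h.mono hi

theorem isDiscrete_iff_injective {V X : Type*} {f : V → X} :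
    IsDiscrete f ↔ Function.Injective f := by
  constructor
  · intro h v w hvw
    have : v ∈ f ⁻¹' {f w} := hvw
    rw [h w] at this
    exact this
  · intro h v
    ext w
    simp [h.eq_iff]

section NodeMultiset

variable {V V' X Y : Type*} [Fintype V] [Fintype V']

theorem nodeMultiset_congr {f : V → X} {f' : V' → X} {g : V → Y} {g' : V' → Y}
    (h : nodeMultiset f = nodeMultiset f') (hi : ∀ x y, f x = f' y → g x = g' y) :
    nodeMultiset g = nodeMultiset g' :=
  map_eq_map_of_imp h fun x _ y _ => hi x y

theorem card_eq_of_nodeMultiset_eq {f : V → X} {f' : V' → X}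
    (h : nodeMultiset f = nodeMultiset f') : Fintype.card V = Fintype.card V' := by
  simpa [nodeMultiset] using congrArg Multiset.card h

open Classical in
theorem count_nodeMultiset (f : V → X) (a : X) :
    (nodeMultiset f).count a = (colorClass f a).card := by
  unfold nodeMultiset colorClass
  rw [Multiset.count_map, Finset.card_def, Finset.filter_val]
  simp only [eq_comm]

theorem card_colorClass_eq {f : V → X} {f' : V' → X}
    (h : nodeMultiset f = nodeMultiset f') (a : X) :
    (colorClass f a).card = (colorClass f' a).card := by
  classical
  rw [← count_nodeMultiset, ← count_nodeMultiset, h]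

theorem nodeMultiset_eq_of_card {f : V → X} {f' : V' → X}
    (h : ∀ a, (colorClass f a).card = (colorClass f' a).card) :
    nodeMultiset f = nodeMultiset f' := by
  classical
  ext a
  rw [count_nodeMultiset, count_nodeMultiset, h]

@[simp] theorem mem_colorClass {f : V → X} {a : X} {v : V} : v ∈ colorClass f a ↔ f v = a := by
  simp [colorClass]

theorem exists_equiv_of_nodeMultiset_eq {f : V → X} {f' : V' → X}
    (h : nodeMultiset f = nodeMultiset f') : ∃ e : V ≃ V', ∀ v, f' (e v) = f v := by
  classical
  have hc (a : X) : Nonempty ({v // f v = a} ≃ {v // f' v = a}) := by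
    apply Fintype.card_eq.mp
    have := card_colorClass_eq h a
    simpa [colorClass, Fintype.card_subtype] using this
  let e := (Equiv.sigmaFiberEquiv f).symm.trans
    ((Equiv.sigmaCongrRight fun a => (hc a).some).trans (Equiv.sigmaFiberEquiv f'))
  refine ⟨e, fun v => ?_⟩
  exact ((hc (f v)).some ⟨v, rfl⟩).2

theorem isDiscrete_iff_of_nodeMultiset_eq {f : V → X} {f' : V' → X}
    (h : nodeMultiset f = nodeMultiset f') : IsDiscrete f ↔ IsDiscrete f' := by
  obtain ⟨e, he⟩ := exists_equiv_of_nodeMultiset_eq h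
  have : f = f' ∘ e := funext fun v => (he v).symm
  rw [isDiscrete_iff_injective, isDiscrete_iff_injective, this, e.injective_comp]

theorem repeatedColors_eq {f : V → X} {f' : V' → X}
    (h : nodeMultiset f = nodeMultiset f') : repeatedColors f = repeatedColors f' := by
  classical
  obtain ⟨e, he⟩ := exists_equiv_of_nodeMultiset_eq h
  ext c
  simp only [repeatedColors, Finset.mem_filter, Finset.mem_image, Finset.mem_univ, true_and,
    card_colorClass_eq h c, and_congr_left_iff]
  intro _
  rw [e.surjective.exists]
  simp [he]

end NodeMultiset

/-! ### Weisfeiler Leman refinement on two graphs -/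

section Refinement

variable {P C V V' X Y : Type*} [Fintype V] [Fintype V']
  {G : LabeledGraph P V} {G' : LabeledGraph P V'}

theorem nbrMultiset_congr {f : V → X} {f' : V' → X} {g : V → Y} {g' : V' → Y} {v : V} {v' : V'}
    (h : nbrMultiset G f v = nbrMultiset G' f' v')
    (hi : ∀ x, G.graph.Adj v x → ∀ y, G'.graph.Adj v' y → f x = f' y → g x = g' y) :
    nbrMultiset G g v = nbrMultiset G' g' v' :=
  map_eq_map_of_imp h (by simpa using hi)

theorem mem_nbrMultiset {f : V → X} {v : V} {a : X} :
    a ∈ nbrMultiset G f v ↔ ∃ u, G.graph.Adj v u ∧ f u = a := by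
  simp [nbrMultiset]

/-- The part of the injectivity of a hash function that refinement relies on. -/
def RefineInjective (hash : HashInput P C → C) : Prop :=
  ∀ c m c' m', hash (.refine c m) = hash (.refine c' m') → c = c' ∧ m = m'

theorem wl_wl_one (hash : HashInput P C → C) (G : LabeledGraph P V) (c : V → C) (k : ℕ) :
    wl hash G (wl hash G c 1) k = wl hash G c (k + 1) := by
  induction k with
  | zero => rfl
  | succ k ih => rw [wl, ih]; rfl

theorem wl_eq_of_succ {hash : HashInput P C → C} (hh : RefineInjective hash)
    {c : V → C} {c' : V' → C} {k : ℕ} {x : V} {y : V'}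
    (h : wl hash G c (k + 1) x = wl hash G' c' (k + 1) y) :
    wl hash G c k x = wl hash G' c' k y :=
  (hh _ _ _ _ h).1

theorem initial_eq_of_wl_eq {hash : HashInput P C → C} (hh : RefineInjective hash)
    {c : V → C} {c' : V' → C} {k : ℕ} {x : V} {y : V'}
    (h : wl hash G c k x = wl hash G' c' k y) : c x = c' y := by
  induction k with
  | zero => exact h
  | succ k ih => exact ih (wl_eq_of_succ hh h)

/-- One more round separates no new pair of nodes if the round before it did not, where the pairs
may be taken across two graphs. -/
theorem wl_succ_eq_of_wl_succ_eq {hash : HashInput P C → C} (hh : RefineInjective hash)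
    {c : V → C} {c' : V' → C} {k : ℕ}
    (hk : ∀ x y, wl hash G c k x = wl hash G' c' k y →
      wl hash G c (k + 1) x = wl hash G' c' (k + 1) y)
    {x : V} {y : V'} (h : wl hash G c (k + 1) x = wl hash G' c' (k + 1) y) :
    wl hash G c (k + 2) x = wl hash G' c' (k + 2) y := by
  have h2 := (hh _ _ _ _ h).2
  change hash (.refine _ _) = hash (.refine _ _)
  rw [h, nbrMultiset_congr h2 fun x _ y _ => hk x y]

theorem image_eq_image_extend {W : Type*} [Fintype W] [DecidableEq C] {F F' : W → C}
    (h : ∀ x y, F' x = F' y → F x = F y) :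
    Finset.univ.image F = (Finset.univ.image F').image (Function.extend F' F id) := by
  have hf : F.FactorsThrough F' := fun x y => h x y
  rw [Finset.image_image]
  congr 1
  ext x
  exact (hf.extend_apply _ _).symm

theorem card_image_le_of_imp {W : Type*} [Fintype W] [DecidableEq C] {F F' : W → C}
    (h : ∀ x y, F' x = F' y → F x = F y) :
    (Finset.univ.image F).card ≤ (Finset.univ.image F').card := by
  rw [image_eq_image_extend h]
  exact Finset.card_image_le

theorem imp_of_card_image_eq {W : Type*} [Fintype W] [DecidableEq C] {F F' : W → C}
    (h : ∀ x y, F' x = F' y → F x = F y)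
    (hc : (Finset.univ.image F).card = (Finset.univ.image F').card) {x y : W}
    (hxy : F x = F y) : F' x = F' y := by
  have hf : F.FactorsThrough F' := fun x y => h x y
  rw [image_eq_image_extend h] at hc
  refine Finset.card_image_iff.mp hc (by simp) (by simp) ?_
  rw [hf.extend_apply, hf.extend_apply, hxy]

/-- After `|V| + |V'|` rounds refinement is stable on the disjoint union of the two graphs: the
number of colours in use never decreases, is bounded by the number of nodes, and stays constant
once two consecutive values agree. -/
theorem nbrMultiset_wl_eq {hash : HashInput P C → C} (hh : RefineInjective hash)
    {c : V → C} {c' : V' → C} {n : ℕ} (hn : Fintype.card V + Fintype.card V' ≤ n)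
    {x : V} {y : V'} (h : wl hash G c n x = wl hash G' c' n y) :
    nbrMultiset G (wl hash G c n) x = nbrMultiset G' (wl hash G' c' n) y := by
  classical
  let F (k : ℕ) : V ⊕ V' → C := Sum.elim (wl hash G c k) (wl hash G' c' k)
  let N (k : ℕ) : ℕ := (Finset.univ.image (F k)).card
  have hF (k : ℕ) : ∀ x y, F (k + 1) x = F (k + 1) y → F k x = F k y := by
    rintro (x | x) (y | y) h <;> exact wl_eq_of_succ hh h
  have hmono : Monotone N := monotone_nat_of_le_succ fun k => card_image_le_of_imp (hF k)
  have hbound (k : ℕ) : N k ≤ Fintype.card V + Fintype.card V' := by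
    rw [← Fintype.card_sum]
    exact Finset.card_image_le
  have hstab (k : ℕ) (hk : N k = N (k + 1)) : N (k + 1) = N (k + 2) := by
    have h1 : ∀ x y, F k x = F k y → F (k + 1) x = F (k + 1) y := fun x y =>
      imp_of_card_image_eq (hF k) hk
    refine le_antisymm (hmono (Nat.le_succ _)) (card_image_le_of_imp ?_)
    rintro (x | x) (y | y) h
    · exact wl_succ_eq_of_wl_succ_eq hh (fun x y => h1 (.inl x) (.inl y)) h
    · exact wl_succ_eq_of_wl_succ_eq hh (fun x y => h1 (.inl x) (.inr y)) h
    · exact wl_succ_eq_of_wl_succ_eq hh (fun x y => h1 (.inr x) (.inl y)) h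
    · exact wl_succ_eq_of_wl_succ_eq hh (fun x y => h1 (.inr x) (.inr y)) h
  have hN : N n = N (n + 1) := by
    rw [Nat.stabilises_of_monotone hmono hbound hstab hn,
      Nat.stabilises_of_monotone hmono hbound hstab (hn.trans (Nat.le_succ n))]
  have := imp_of_card_image_eq (hF n) hN (x := .inl x) (y := .inr y) h
  exact (hh _ _ _ _ this).2

/-- A set of nodes that contains every neighbour of its members. -/
def ClosedUnderAdj (G : LabeledGraph P V) (U : Set V) : Prop :=
  ∀ x ∈ U, ∀ y, G.graph.Adj x y → y ∈ U

/-- Refinement transfers determination: if `c` determines `e` across two closed sets of nodes,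
then the refinement of `c` determines that of `e`. -/
theorem wl_transfer {hash : HashInput P C → C} (hh : RefineInjective hash)
    {U : Set V} {U' : Set V'}
    (hU : ClosedUnderAdj G U) (hU' : ClosedUnderAdj G' U')
    {c : V → C} {c' : V' → C} {e : V → C} {e' : V' → C}
    (h : ∀ x ∈ U, ∀ y ∈ U', c x = c' y → e x = e' y) (k : ℕ) :
    ∀ x ∈ U, ∀ y ∈ U', wl hash G c k x = wl hash G' c' k y →
      wl hash G e k x = wl hash G' e' k y := by
  induction k with
  | zero => exact h
  | succ k ih =>
    intro x hx y hy hxy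
    obtain ⟨h1, h2⟩ := hh _ _ _ _ hxy
    change hash (.refine _ _) = hash (.refine _ _)
    rw [ih x hx y hy h1, nbrMultiset_congr h2 fun u hu u' hu' =>
      ih u (hU x hx u hu) u' (hU' y hy u' hu')]

/-- Two colourings are cross-stable if nodes of the same colour in the two graphs have equal
multisets of colours at their neighbours. -/
def CrossStable (G : LabeledGraph P V) (G' : LabeledGraph P V') (f : V → X) (f' : V' → X) :
    Prop :=
  ∀ x y, f x = f' y → nbrMultiset G f x = nbrMultiset G' f' y

/-- What a cross-stable pair of colourings determines is also determined after any number of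
refinement rounds. -/
theorem CrossStable.wl_eq {f : V → X} {f' : V' → X} (hs : CrossStable G G' f f')
    (hash : HashInput P C → C) {c : V → C} {c' : V' → C}
    (h : ∀ x y, f x = f' y → c x = c' y) (k : ℕ) :
    ∀ x y, f x = f' y → wl hash G c k x = wl hash G' c' k y := by
  induction k with
  | zero => exact h
  | succ k ih =>
    intro x y hxy
    change hash (.refine _ _) = hash (.refine _ _)
    rw [ih x y hxy, nbrMultiset_congr (hs x y hxy) fun u _ u' _ => ih u u']

end Refinement

/-! ### Colour counts in a component with an individualized node -/

section Component

variable {P V V' X Y : Type*} [Fintype V] [Fintype V']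
  {G : LabeledGraph P V} {G' : LabeledGraph P V'}

open Classical in
theorem count_nbrMultiset (f : V → X) (v : V) (a : X) :
    (nbrMultiset G f v).count a = ((colorClass f a).filter (G.graph.Adj v)).card := by
  unfold nbrMultiset colorClass
  rw [Multiset.count_map, Finset.card_def, Finset.filter_val, Finset.filter_val, Finset.filter_val,
    Multiset.filter_filter, Multiset.filter_filter]
  simp only [eq_comm, and_comm]

open Classical in
/-- The edges between two colour classes, counted from either side. -/
theorem card_colorClass_mul_count {f : V → X} {a b : X} {m k : ℕ}
    (hm : ∀ x, f x = a → (nbrMultiset G f x).count b = m)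
    (hk : ∀ y, f y = b → (nbrMultiset G f y).count a = k) :
    (colorClass f a).card * m = (colorClass f b).card * k := by
  refine Finset.card_mul_eq_card_mul G.graph.Adj (fun x hx => ?_) (fun y hy => ?_)
  · rw [← hm x (by simpa using hx), count_nbrMultiset, Finset.bipartiteAbove]
  · rw [← hk y (by simpa using hy), count_nbrMultiset, Finset.bipartiteBelow]
    simp only [G.graph.adj_comm]

open Classical in
/-- The nodes of the connected component of `w`. -/
noncomputable def component (G : LabeledGraph P V) (w : V) : Finset V :=
  Finset.univ.filter (G.graph.Reachable w)

@[simp] theorem mem_component {w u : V} : u ∈ component G w ↔ G.graph.Reachable w u := by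
  simp [component]

theorem closedUnderAdj_compl_component (w : V) :
    ClosedUnderAdj G {u | u ∉ component G w} := fun x hx y hxy => by
  simp only [mem_component, Set.mem_ofPred_eq] at hx ⊢
  exact fun h => hx (h.trans hxy.symm.reachable)

theorem CrossStable.symm {f : V → X} {f' : V' → X} (hs : CrossStable G G' f f') :
    CrossStable G' G f' f := fun x y h => (hs y x h.symm).symm

theorem CrossStable.exists_adj {f : V → X} {f' : V' → X} (hs : CrossStable G G' f f')
    {u b : V} {u' : V'} (h : f u = f' u') (hb : G.graph.Adj u b) :
    ∃ b', G'.graph.Adj u' b' ∧ f' b' = f b :=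
  mem_nbrMultiset.mp (hs u u' h ▸ mem_nbrMultiset.mpr ⟨b, hb, rfl⟩)

/-- Equality of the sizes of two colour classes spreads along an edge. -/
theorem CrossStable.card_colorClass_eq_of_adj {f : V → X} {f' : V' → X}
    (hs : CrossStable G G' f f') {u b : V} {u' b' : V'} (h : f u = f' u') (hb : f b = f' b')
    (hub : G.graph.Adj u b)
    (hc : (colorClass f (f u)).card = (colorClass f' (f u)).card) :
    (colorClass f (f b)).card = (colorClass f' (f b)).card := by
  classical
  have e := card_colorClass_mul_count (G := G) (f := f) (a := f u) (b := f b)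
    (m := (nbrMultiset G' f' u').count (f b)) (k := (nbrMultiset G' f' b').count (f u))
    (fun x hx => by rw [hs x u' (hx.trans h)]) (fun y hy => by rw [hs y b' (hy.trans hb)])
  have e' := card_colorClass_mul_count (G := G') (f := f') (a := f u) (b := f b)
    (m := (nbrMultiset G' f' u').count (f b)) (k := (nbrMultiset G' f' b').count (f u))
    (fun x hx => by rw [← hs u x hx.symm, hs u u' h])
    (fun y hy => by rw [← hs b y hy.symm, hs b b' hb])
  have hpos : 0 < (nbrMultiset G' f' b').count (f u) := by
    rw [Multiset.count_pos, ← hs b b' hb]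
    exact mem_nbrMultiset.mpr ⟨u, hub.symm, rfl⟩
  rw [hc, e'] at e
  exact (Nat.eq_of_mul_eq_mul_right hpos e).symm

/-- Starting from a node `w` whose colour is unique, cross-stability propagates three facts along
walks: colours of the component of `w` occur in the component of `w'`, in classes of equal size,
and those classes do not leave the component. -/
theorem CrossStable.component_induction {f : V → X} {f' : V' → X}
    (hs : CrossStable G G' f f') {w : V} {w' : V'} (hw : f w = f' w')
    (hu : ∀ x, f x = f w → x = w) (hu' : ∀ x, f' x = f' w' → x = w')
    {u : V} (h : G.graph.Reachable w u) :
    (∃ u', G'.graph.Reachable w' u' ∧ f u = f' u') ∧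
      (colorClass f (f u)).card = (colorClass f' (f u)).card ∧
      ∀ x, f x = f u → G.graph.Reachable w x := by
  rw [SimpleGraph.reachable_iff_reflTransGen] at h
  induction h with
  | refl =>
    refine ⟨⟨w', .refl _, hw⟩, ?_, fun x hx => hu x hx ▸ .refl _⟩
    have h1 : colorClass f (f w) = {w} := by
      ext x
      simpa using ⟨hu x, fun h => h ▸ rfl⟩
    have h2 : colorClass f' (f w) = {w'} := by
      ext x
      simpa [hw] using ⟨hu' x, fun h => h ▸ rfl⟩
    rw [h1, h2, Finset.card_singleton, Finset.card_singleton]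
  | @tail u b _ hub ih =>
    obtain ⟨⟨u', hru', huu'⟩, hc, hr⟩ := ih
    obtain ⟨b', hub', hb'⟩ := hs.exists_adj huu' hub
    refine ⟨⟨b', hru'.trans hub'.reachable, hb'.symm⟩,
      hs.card_colorClass_eq_of_adj huu' hb'.symm hub hc, fun x hx => ?_⟩
    -- `x` has the same neighbour colours as `b'`, hence as `b`, and so a neighbour coloured like `u`.
    obtain ⟨y, hxy, hy⟩ := hs.symm.exists_adj (hb'.trans hx.symm) hub'.symm
    exact (hr y (hy.trans huu'.symm)).trans hxy.symm.reachable

open Classical in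
theorem count_map_component (f : V → X) (w : V) (a : X) :
    ((component G w).val.map f).count a =
      ((colorClass f a).filter (G.graph.Reachable w)).card := by
  unfold component colorClass
  rw [Multiset.count_map, Finset.card_def, Finset.filter_val, Finset.filter_val, Finset.filter_val,
    Multiset.filter_filter, Multiset.filter_filter]
  simp only [eq_comm, and_comm]

theorem CrossStable.count_component_le {f : V → X} {f' : V' → X}
    (hs : CrossStable G G' f f') {w : V} {w' : V'} (hw : f w = f' w')
    (hu : ∀ x, f x = f w → x = w) (hu' : ∀ x, f' x = f' w' → x = w') :
    (component G w).val.map f ≤ (component G' w').val.map f' := by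
  classical
  rw [Multiset.le_iff_count]
  intro a
  by_cases ha : ∃ u, G.graph.Reachable w u ∧ f u = a
  · obtain ⟨u, hru, rfl⟩ := ha
    obtain ⟨⟨u', hru', huu'⟩, hc, -⟩ := hs.component_induction hw hu hu' hru
    obtain ⟨-, -, hr'⟩ := hs.symm.component_induction hw.symm hu' hu hru'
    rw [count_map_component, count_map_component,
      Finset.filter_true_of_mem (s := colorClass f' (f u)), ← hc]
    · exact Finset.card_filter_le _ _
    · intro x hx
      exact hr' x (by rw [← huu']; simpa using hx)
  · rw [Multiset.count_eq_zero_of_notMem]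
    · exact Nat.zero_le _
    · simpa using ha

/-- A cross-stable pair of colourings in which `w` and `w'` have the same colour, unique in either
graph, uses every colour equally often in the components of `w` and `w'`. -/
theorem CrossStable.map_component_eq {f : V → X} {f' : V' → X}
    (hs : CrossStable G G' f f') {w : V} {w' : V'} (hw : f w = f' w')
    (hu : ∀ x, f x = f w → x = w) (hu' : ∀ x, f' x = f' w' → x = w') :
    (component G w).val.map f = (component G' w').val.map f' :=
  le_antisymm (hs.count_component_le hw hu hu') (hs.symm.count_component_le hw.symm hu' hu)

theorem nodeMultiset_eq_add (f : V → X) (s : Finset V) [DecidableEq V] :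
    nodeMultiset f = s.val.map f + (sᶜ).val.map f := by
  rw [← Multiset.map_add]
  unfold nodeMultiset
  congr 1
  have := Finset.disjUnion_val (s := s) (t := sᶜ) disjoint_compl_right
  rw [← this]
  congr 1
  ext
  simp

end Component

/-! ### HE-GNNs that simulate refinement -/

/-- The colours used by the simulating networks. -/
abbrev RealColor := Fin 1 → ℝ

theorem exists_encode (D : ℕ) : ∃ f : (Fin D → ℝ) → RealColor, Function.Injective f := by
  have h : Cardinal.mk (Fin D → ℝ) ≤ Cardinal.mk RealColor := by
    simpa [Cardinal.mk_real] using
      Cardinal.power_nat_le (n := D) Cardinal.aleph0_le_continuum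
  obtain ⟨f⟩ := h
  exact ⟨f, f.injective⟩

theorem exists_encodeMultiset :
    ∃ f : Multiset RealColor → RealColor, Function.Injective f := by
  have h : Cardinal.mk (Multiset RealColor) ≤ Cardinal.mk RealColor :=
    (Cardinal.mk_multiset_of_infinite _).le
  obtain ⟨f⟩ := h
  exact ⟨f, f.injective⟩

/-- An injective encoding of real vectors by a single real number. -/
noncomputable def encode (D : ℕ) : (Fin D → ℝ) → RealColor := (exists_encode D).choose

theorem encode_injective (D : ℕ) : Function.Injective (encode D) := (exists_encode D).choose_spec

/-- An injective encoding of finite multisets of real colours by a single real colour. -/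
noncomputable def encodeMultiset : Multiset RealColor → RealColor := exists_encodeMultiset.choose

theorem encodeMultiset_injective : Function.Injective encodeMultiset :=
  exists_encodeMultiset.choose_spec

theorem append_inj {D E : ℕ} {a b : Fin D → ℝ} {x y : Fin E → ℝ}
    (h : Fin.append a x = Fin.append b y) : a = b ∧ x = y := by
  constructor
  · funext i
    simpa using congrFun h (Fin.castAdd E i)
  · funext i
    simpa using congrFun h (Fin.natAdd D i)

/-- The hash function computed by `refineLayer`. Only its values at `refine` matter. -/
noncomputable def realHash {P : Type*} : HashInput P RealColor → RealColor
  | .refine c m => encode 2 (Fin.append c (encodeMultiset m))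
  | _ => 0

theorem refineInjective_realHash {P : Type*} :
    RefineInjective (realHash (P := P)) := fun c m c' m' h => by
  obtain ⟨h1, h2⟩ := append_inj (encode_injective 2 h)
  exact ⟨h1, encodeMultiset_injective h2⟩

/-- A layer that replaces the vector `x` at each node by `g x` and ignores the neighbours. -/
def pointwiseLayer {D : ℕ} (g : (Fin D → ℝ) → RealColor) : GNNLayer D 1 where
  agg _ := 0
  com x := g fun i => x (Fin.castAdd D i)
  pos := le_rfl

/-- A layer that performs one round of refinement. -/
noncomputable def refineLayer : GNNLayer 1 1 where
  agg := encodeMultiset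
  com := encode 2
  pos := le_rfl

/-- `n` rounds of refinement followed by the pointwise application of `g`. -/
noncomputable def refineGNN (g : RealColor → RealColor) : ℕ → GNN 1 1
  | 0 => .last (pointwiseLayer g)
  | n + 1 => .cons refineLayer (refineGNN g n)

/-- The encoding of the input vectors by colours, followed by `refineGNN`. -/
noncomputable def encodeRefineGNN (D n : ℕ) (g : RealColor → RealColor) : GNN D 1 :=
  .cons (pointwiseLayer (encode D)) (refineGNN g n)

/-- An HE-GNN of nesting depth `d` that refines as much as possible within `n` rounds at every
nesting level and applies `g` to the final colours. -/
noncomputable def refineHEGNN (n : ℕ) : (d D : ℕ) → (RealColor → RealColor) → HEGNN d D 1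
  | 0, D, g => .base (encodeRefineGNN D n g)
  | d + 1, D, g => .nest (refineHEGNN n d (D + 1) id) (encodeRefineGNN (D + 1) n g)

section Simulation

variable {P V V' : Type*} [Fintype V] [Fintype V']

theorem run_pointwiseLayer (G : LabeledGraph P V) {D : ℕ} (g : (Fin D → ℝ) → RealColor)
    (emb : V → Fin D → ℝ) : (pointwiseLayer g).run G emb = g ∘ emb := by
  funext v
  simp [GNNLayer.run, pointwiseLayer]

theorem run_refineLayer (G : LabeledGraph P V) (c : V → RealColor) :
    refineLayer.run G c = wl realHash G c 1 := rfl

theorem run_refineGNN (G : LabeledGraph P V) (g : RealColor → RealColor) (n : ℕ)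
    (c : V → RealColor) : (refineGNN g n).run G c = g ∘ wl realHash G c n := by
  induction n generalizing c with
  | zero => exact run_pointwiseLayer G g c
  | succ n ih =>
    rw [refineGNN, GNN.run, ih, run_refineLayer, wl_wl_one]

theorem run_encodeRefineGNN (G : LabeledGraph P V) (D n : ℕ) (g : RealColor → RealColor)
    (emb : V → Fin D → ℝ) :
    (encodeRefineGNN D n g).run G emb = g ∘ wl realHash G (encode D ∘ emb) n := by
  rw [encodeRefineGNN, GNN.run, run_refineGNN, run_pointwiseLayer]

/-- The colouring computed by `refineHEGNN`: at depth `0` refinement of the embedding, at depth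
`d + 1` refinement of the embedding paired, at every node `v`, with the depth-`d` colour of `v`
after `v` has been marked. -/
noncomputable def egoColor (n : ℕ) (G : LabeledGraph P V) :
    (d : ℕ) → {D : ℕ} → (V → Fin D → ℝ) → V → RealColor
  | 0, D, emb => wl realHash G (encode D ∘ emb) n
  | d + 1, D, emb =>
      wl realHash G
        (encode (D + 1) ∘ fun v => Fin.append (emb v) (egoColor n G d (mark emb v) v)) n

theorem run_refineHEGNN (n : ℕ) (G : LabeledGraph P V) (d : ℕ) {D : ℕ}
    (g : RealColor → RealColor) (emb : V → Fin D → ℝ) :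
    (refineHEGNN n d D g).run G emb = g ∘ egoColor n G d emb := by
  induction d generalizing D g with
  | zero => exact run_encodeRefineGNN G D n g emb
  | succ d ih =>
    rw [refineHEGNN, HEGNN.run, run_encodeRefineGNN, egoColor]
    simp only [ih]
    rfl

open Classical in
/-- The function that maps the colour `r` to `1` and all other colours to `0`. -/
noncomputable def colorIndicator (r : RealColor) : RealColor → RealColor :=
  fun c => if c = r then 1 else 0

theorem colorClass_cls_refineHEGNN [Fintype P] (n : ℕ) (G : LabeledGraph P V) (d : ℕ)
    (r : RealColor) :
    colorClass ((refineHEGNN n d _ (colorIndicator r)).cls G) 1 =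
      colorClass (egoColor n G d (multiHot G)) r := by
  ext v
  rw [mem_colorClass, mem_colorClass, HEGNN.cls, run_refineHEGNN, Function.comp, colorIndicator]
  by_cases hv : egoColor n G d (multiHot G) v = r <;> simp [hv]

/-- HE-GNN equivalence forces equal multisets of ego colours, since for every colour `r` the
network can be completed to a classifier that accepts exactly the nodes coloured `r`. -/
theorem HEGNNEquiv.nodeMultiset_egoColor_eq [Fintype P] {d : ℕ} {G : LabeledGraph P V}
    {G' : LabeledGraph P V'} (h : HEGNNEquiv d G G') (n : ℕ) :
    nodeMultiset (egoColor n G d (multiHot G)) = nodeMultiset (egoColor n G' d (multiHot G')) := by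
  refine nodeMultiset_eq_of_card fun r => ?_
  rw [← colorClass_cls_refineHEGNN, ← colorClass_cls_refineHEGNN, card_colorClass_eq (h _)]

end Simulation

/-! ### Ego colours determine individualization-refinement -/

theorem mark_eq_mark_iff {V V' : Type*} {D : ℕ} {emb : V → Fin D → ℝ} {emb' : V' → Fin D → ℝ}
    {w x : V} {w' y : V'} :
    mark emb w x = mark emb' w' y ↔ emb x = emb' y ∧ (x = w ↔ y = w') := by
  constructor
  · intro h
    obtain ⟨h1, h2⟩ := append_inj h
    refine ⟨h1, ?_⟩
    have h3 := congrFun h2 0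
    by_cases hx : x = w <;> by_cases hy : y = w' <;> simp_all
  · rintro ⟨h1, h2⟩
    by_cases hy : y = w'
    · unfold mark
      rw [h1, if_pos hy, if_pos (h2.mpr hy)]
    · unfold mark
      rw [h1, if_neg hy, if_neg (mt h2.mp hy)]

section EgoColor

variable {P V V' : Type*} [Fintype V] [Fintype V']
  {G : LabeledGraph P V} {G' : LabeledGraph P V'} {n d D E : ℕ}

theorem emb_eq_and_egoColor_mark_eq {emb : V → Fin D → ℝ} {emb' : V' → Fin D → ℝ}
    {x : V} {y : V'} (h : egoColor n G (d + 1) emb x = egoColor n G' (d + 1) emb' y) :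
    emb x = emb' y ∧
      egoColor n G d (mark emb x) x = egoColor n G' d (mark emb' y) y := by
  unfold egoColor at h
  have h₁ := initial_eq_of_wl_eq refineInjective_realHash h
  exact append_inj (encode_injective _ h₁)

theorem egoColor_mark_eq {emb : V → Fin D → ℝ} {emb' : V' → Fin D → ℝ} {x : V} {y : V'}
    (h : egoColor n G (d + 1) emb x = egoColor n G' (d + 1) emb' y) :
    egoColor n G d (mark emb x) x = egoColor n G' d (mark emb' y) y :=
  (emb_eq_and_egoColor_mark_eq h).2

theorem emb_eq_of_egoColor_eq {emb : V → Fin D → ℝ} {emb' : V' → Fin D → ℝ} {x : V} {y : V'}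
    (h : egoColor n G d emb x = egoColor n G' d emb' y) : emb x = emb' y := by
  cases d with
  | zero =>
    unfold egoColor at h
    have h₁ := initial_eq_of_wl_eq refineInjective_realHash h
    exact encode_injective _ h₁
  | succ d => exact (emb_eq_and_egoColor_mark_eq h).1

theorem crossStable_egoColor (hn : Fintype.card V + Fintype.card V' ≤ n)
    (emb : V → Fin D → ℝ) (emb' : V' → Fin D → ℝ) :
    CrossStable G G' (egoColor n G d emb) (egoColor n G' d emb') := by
  cases d with
  | zero => exact fun x y h => nbrMultiset_wl_eq refineInjective_realHash hn h
  | succ d => exact fun x y h => nbrMultiset_wl_eq refineInjective_realHash hn h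

/-- If one pair of embeddings determines another one across two closed sets of nodes, then so do
the ego colours. In particular these depend only on the component of a node. -/
theorem egoColor_transfer {U : Set V} {U' : Set V'}
    (hU : ClosedUnderAdj G U) (hU' : ClosedUnderAdj G' U')
    {emb : V → Fin D → ℝ} {emb' : V' → Fin D → ℝ} {emb₁ : V → Fin E → ℝ} {emb₁' : V' → Fin E → ℝ}
    (h : ∀ x ∈ U, ∀ y ∈ U', emb x = emb' y → emb₁ x = emb₁' y) :
    ∀ x ∈ U, ∀ y ∈ U', egoColor n G d emb x = egoColor n G' d emb' y →
      egoColor n G d emb₁ x = egoColor n G' d emb₁' y := by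
  induction d generalizing D E with
  | zero =>
    refine wl_transfer refineInjective_realHash hU hU' (fun x hx y hy hxy => ?_) n
    exact congrArg (encode E) (h x hx y hy (encode_injective _ hxy))
  | succ d ih =>
    refine wl_transfer refineInjective_realHash hU hU' (fun x hx y hy hxy => ?_) n
    obtain ⟨h1, h2⟩ := append_inj (encode_injective _ hxy)
    have h3 : egoColor n G d (mark emb₁ x) x = egoColor n G' d (mark emb₁' y) y := by
      refine ih (fun u hu v hv huv => ?_) x hx y hy h2
      rw [mark_eq_mark_iff] at huv ⊢
      exact ⟨h u hu v hv huv.1, huv.2⟩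
    simp only [Function.comp_apply, h x hx y hy h1, h3]

theorem egoColor_eq_of_mark {emb : V → Fin D → ℝ} {emb' : V' → Fin D → ℝ} {w x : V} {w' y : V'}
    (h : egoColor n G d (mark emb w) x = egoColor n G' d (mark emb' w') y) :
    egoColor n G d emb x = egoColor n G' d emb' y :=
  egoColor_transfer (U := Set.univ) (U' := Set.univ) (fun _ _ _ _ => trivial)
    (fun _ _ _ _ => trivial) (fun _ _ _ _ h => (mark_eq_mark_iff.mp h).1) x trivial y trivial h

theorem egoColor_eq_of_succ {emb : V → Fin D → ℝ} {emb' : V' → Fin D → ℝ} {x : V} {y : V'}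
    (h : egoColor n G (d + 1) emb x = egoColor n G' (d + 1) emb' y) :
    egoColor n G d emb x = egoColor n G' d emb' y :=
  egoColor_eq_of_mark (egoColor_mark_eq h)

theorem egoColor_zero_eq {emb : V → Fin D → ℝ} {emb' : V' → Fin D → ℝ} {x : V} {y : V'}
    (h : egoColor n G d emb x = egoColor n G' d emb' y) :
    egoColor n G 0 emb x = egoColor n G' 0 emb' y := by
  induction d with
  | zero => exact h
  | succ d ih => exact ih (egoColor_eq_of_succ h)

/-- Marking two nodes of the same ego colour at depth `d + 1` keeps the multisets of ego colours at
depth `d` equal. Inside the components of the two nodes the marks allow the colours to be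
counted; outside, the marks have no effect, and there the multisets agree because they agree on
the whole graphs and on the components. -/
theorem nodeMultiset_egoColor_mark_eq (hn : Fintype.card V + Fintype.card V' ≤ n)
    {emb : V → Fin D → ℝ} {emb' : V' → Fin D → ℝ}
    (h : nodeMultiset (egoColor n G (d + 1) emb) = nodeMultiset (egoColor n G' (d + 1) emb'))
    {w : V} {w' : V'} (hw : egoColor n G (d + 1) emb w = egoColor n G' (d + 1) emb' w') :
    nodeMultiset (egoColor n G d (mark emb w)) = nodeMultiset (egoColor n G' d (mark emb' w')) := by
  classical
  have hin : (component G w).val.map (egoColor n G d (mark emb w)) =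
      (component G' w').val.map (egoColor n G' d (mark emb' w')) := by
    refine (crossStable_egoColor hn _ _).map_component_eq (egoColor_mark_eq hw) ?_ ?_
    · exact fun x hx => (mark_eq_mark_iff.mp (emb_eq_of_egoColor_eq hx)).2.mpr rfl
    · exact fun x hx => (mark_eq_mark_iff.mp (emb_eq_of_egoColor_eq hx)).2.mpr rfl
  have hin₀ : (component G w).val.map (egoColor n G d emb) =
      (component G' w').val.map (egoColor n G' d emb') :=
    map_eq_map_of_imp hin fun x _ y _ => egoColor_eq_of_mark
  have hall : nodeMultiset (egoColor n G d emb) = nodeMultiset (egoColor n G' d emb') :=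
    nodeMultiset_congr h fun x y => egoColor_eq_of_succ
  rw [nodeMultiset_eq_add _ (component G w), nodeMultiset_eq_add _ (component G' w'), hin₀,
    add_right_inj] at hall
  rw [nodeMultiset_eq_add _ (component G w), nodeMultiset_eq_add _ (component G' w'), hin,
    add_right_inj]
  refine map_eq_map_of_imp hall fun x hx y hy => ?_
  refine egoColor_transfer (closedUnderAdj_compl_component w) (closedUnderAdj_compl_component w')
    (fun u hu v hv huv => ?_) x (by simpa using hx) y (by simpa using hy)
  -- Outside the components no node is marked.
  have hu' : u ≠ w := fun e => hu (e ▸ mem_component.mpr (.refl _))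
  have hv' : v ≠ w' := fun e => hv (e ▸ mem_component.mpr (.refl _))
  simp [mark_eq_mark_iff, huv, hu', hv']

theorem ColTree.iso_leaf {C : Type*} {c : V → C} {c' : V' → C}
    (h : nodeMultiset c = nodeMultiset c') :
    (ColTree.leaf c).Iso (ColTree.leaf c') :=
  ⟨h, Equiv.equivOfIsEmpty _ _, fun i => absurd i.2 (Finset.notMem_empty i.1)⟩

/-- Refinement of the colourings in `|V|` rounds is still determined by the refined embeddings. -/
theorem wl_eq_of_egoColor_zero_eq {C : Type*} (hash : HashInput P C → C)
    (hn : Fintype.card V + Fintype.card V' ≤ n) (hV : Fintype.card V = Fintype.card V')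
    {emb : V → Fin D → ℝ} {emb' : V' → Fin D → ℝ} {col : V → C} {col' : V' → C}
    (hcol : ∀ x y, egoColor n G 0 emb x = egoColor n G' 0 emb' y → col x = col' y)
    (x : V) (y : V') (hxy : egoColor n G 0 emb x = egoColor n G' 0 emb' y) :
    wl hash G col (Fintype.card V) x = wl hash G' col' (Fintype.card V') y := by
  rw [hV]
  exact (crossStable_egoColor hn emb emb').wl_eq hash hcol _ x y hxy

/-- If the embeddings, refined, determine the colourings across the two graphs, then equal
multisets of ego colours at depth `d` give isomorphic trees of depth `d`. -/
theorem wlir_iso {C : Type*} [LinearOrder C] (hash : HashInput P C → C)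
    (hn : Fintype.card V + Fintype.card V' ≤ n)
    {emb : V → Fin D → ℝ} {emb' : V' → Fin D → ℝ} {col : V → C} {col' : V' → C}
    (hcol : ∀ x y, egoColor n G 0 emb x = egoColor n G' 0 emb' y → col x = col' y)
    (h : nodeMultiset (egoColor n G d emb) = nodeMultiset (egoColor n G' d emb')) :
    (wlir hash G col d).Iso (wlir hash G' col' d) := by
  induction d generalizing D col col' with
  | zero =>
    have hwl₀ := wl_eq_of_egoColor_zero_eq hash hn (card_eq_of_nodeMultiset_eq h) hcol
    have hwl : nodeMultiset (wl hash G col (Fintype.card V)) =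
        nodeMultiset (wl hash G' col' (Fintype.card V')) :=
      nodeMultiset_congr h fun x y hxy => hwl₀ x y (egoColor_zero_eq hxy)
    rw [wlir, wlir]
    exact ColTree.iso_leaf hwl
  | succ d ih =>
    have hwl₀ := wl_eq_of_egoColor_zero_eq hash hn (card_eq_of_nodeMultiset_eq h) hcol
    have hwl : nodeMultiset (wl hash G col (Fintype.card V)) =
        nodeMultiset (wl hash G' col' (Fintype.card V')) :=
      nodeMultiset_congr h fun x y hxy => hwl₀ x y (egoColor_zero_eq hxy)
    rw [wlir, wlir]
    by_cases hd : IsDiscrete (wl hash G col (Fintype.card V))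
    · have hd' := (isDiscrete_iff_of_nodeMultiset_eq hwl).mp hd
      simp only [hd, hd', dif_pos]
      exact ColTree.iso_leaf hwl
    · have hd' := mt (isDiscrete_iff_of_nodeMultiset_eq hwl).mpr hd
      simp only [hd, hd', dif_neg, not_false_eq_true]
      obtain ⟨e, he⟩ := exists_equiv_of_nodeMultiset_eq h
      have hec (v : V) : wl hash G' col' (Fintype.card V') (e v) =
          wl hash G col (Fintype.card V) v :=
        (hwl₀ v (e v) (egoColor_zero_eq (he v).symm)).symm
      refine ⟨hwl, e.subtypeEquiv fun v => ?_, fun w => ?_⟩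
      · simp only [mem_colorClass, hec, repeatedColors_eq hwl]
      · have hw : egoColor n G (d + 1) emb w.1 = egoColor n G' (d + 1) emb' (e w.1) :=
          (he w.1).symm
        have hcol₁ (x : V) (y : V') (hxy : egoColor n G 0 (mark emb w.1) x =
            egoColor n G' 0 (mark emb' (e w.1)) y) :
            individualize hash (wl hash G col (Fintype.card V)) w.1 x =
              individualize hash (wl hash G' col' (Fintype.card V')) (e w.1) y := by
          have hm := (mark_eq_mark_iff.mp (emb_eq_of_egoColor_eq hxy)).2
          rw [individualize, individualize, hwl₀ x y (egoColor_eq_of_mark hxy)]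
          by_cases hy : y = e w.1
          · rw [if_pos hy, if_pos (hm.mpr hy)]
          · rw [if_neg hy, if_neg (mt hm.mp hy)]
        exact ih hcol₁ (nodeMultiset_egoColor_mark_eq hn h hw)

end EgoColor

theorem label_eq_of_multiHot_eq {P V V' : Type*} [Fintype P] {G : LabeledGraph P V}
    {G' : LabeledGraph P V'} {x : V} {y : V'}
    (h : multiHot G x = multiHot G' y) : G.lab x = G'.lab y := by
  ext p
  have := congrFun h (Fintype.equivFin P p)
  by_cases hx : p ∈ G.lab x <;> by_cases hy : p ∈ G'.lab y <;> simp_all [multiHot]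

end EgoNet

theorem mainTheorem4 {P C V V' : Type*} [Fintype P]
    [LinearOrder C] [Countable C] [Infinite C]
    (hash : EgoNet.HashInput P C → C) (hash_inj : Function.Injective hash)
    [Fintype V] [Fintype V']
    (G : EgoNet.LabeledGraph P V) (G' : EgoNet.LabeledGraph P V') (d : ℕ)
    (h : ¬ EgoNet.WLIREquiv hash d G G') :
    ¬ EgoNet.HEGNNEquiv d G G' := by
  refine fun he => h (EgoNet.wlir_iso hash le_rfl (fun x y hxy => ?_)
    (he.nodeMultiset_egoColor_eq (Fintype.card V + Fintype.card V')))
  simp only [EgoNet.initCol, EgoNet.label_eq_of_multiHot_eq (EgoNet.emb_eq_of_egoColor_eq hxy)]
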